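/- Let $\mathcal{S}$ be a small additive category. A (right) $\mathcal{S}$-module is an additive functor $\mathcal{S}^{\mathrm{op}} \to \mathrm{Ab}$; these form an abelian category, and $\operatorname{Ext}^1_{\mathcal{S}}$ denotes its first extension group. An $\mathcal{S}$-module is flat if it is a direct limit of finitely generated projective $\mathcal{S}$-modules; an $\mathcal{S}$-module $Y$ is cotorsion if $\operatorname{Ext}^1_{\mathcal{S}}(F,Y)=0$ for all flat $\mathcal{S}$-modules $F$; and $F$ has finite flat dimension if there are $n \ge 0$ and an exact sequence $0 \to M_n \to \cdots \to M_0 \to F \to 0$ with all $M_i$ flat. Let $$\cdots \longrightarrow I_2 \longrightarrow I_1 \longrightarrow I_0 \longrightarrow X \longrightarrow 0$$ be an exact sequence of $\mathcal{S}$-modules such that $I_n$ is injective for every $n \ge 0$. Then $X$ is cotorsion. In fact, even $\operatorname{Ext}^1_{\mathcal{S}}(F,X)=0$ for every $\mathcal{S}$-module $F$ of finite flat dimension. -/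

import Mathlib

open CategoryTheory CategoryTheory.Limits Opposite

universe u

section AdditiveFunctorsAbelian

variable (C : Type*) [Category* C] [Preadditive C] (D : Type*) [Category* D] [Abelian D]

/-! The category of additive functors into an abelian category is abelian: it is a full subcategory
of the functor category which is closed under subobjects, quotients and finite products. -/

instance additiveFunctor_containsZero : (additiveFunctor C D).ContainsZero where
  exists_zero := by
    obtain ⟨Z, hZ⟩ := HasZeroObject.zero (C := D)
    exact ⟨(Functor.const C).obj Z, Functor.isZero _ fun _ => hZ,
      { map_add := hZ.eq_of_src _ _ }⟩

instance additiveFunctor_isClosedUnderSubobjects :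
    (additiveFunctor C D).IsClosedUnderSubobjects where
  prop_of_mono {F G} i _ hG :=
    { map_add := fun {X Y f g} => by
        have : G.Additive := hG
        rw [← cancel_mono (i.app Y)]
        simp only [NatTrans.naturality, Functor.map_add, Preadditive.comp_add,
          Preadditive.add_comp] }

instance additiveFunctor_isClosedUnderQuotients :
    (additiveFunctor C D).IsClosedUnderQuotients where
  prop_of_epi {F G} p _ hF :=
    { map_add := fun {X Y f g} => by
        have : F.Additive := hF
        rw [← cancel_epi (p.app X)]
        simp only [← NatTrans.naturality, Functor.map_add, Preadditive.comp_add,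
          Preadditive.add_comp] }

instance additiveFunctor_isClosedUnderFiniteProducts :
    (additiveFunctor C D).IsClosedUnderFiniteProducts where
  isClosedUnderLimitsOfShape J _ :=
    { limitsOfShape_le := by
        rintro F ⟨p⟩
        refine { map_add := fun {X Y f g} => ?_ }
        have hY := isLimitOfPreserves ((evaluation C D).obj Y) p.isLimit
        refine hY.hom_ext fun j => ?_
        have : (p.diag.obj j).Additive := p.prop_diag_obj j
        have key : ∀ h : X ⟶ Y, F.map h ≫ (p.π.app j).app Y =
            (p.π.app j).app X ≫ (p.diag.obj j).map h := fun h => (p.π.app j).naturality h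
        change F.map (f + g) ≫ (p.π.app j).app Y = (F.map f + F.map g) ≫ (p.π.app j).app Y
        rw [Preadditive.add_comp, key, key, key, Functor.map_add, Preadditive.comp_add] }

end AdditiveFunctorsAbelian

/-- Right `S`-modules: additive functors `Sᵒᵖ ⥤ Ab`, for a small preadditive category `S`. -/
abbrev RightMod (S : Type u) [SmallCategory S] [Preadditive S] : Type (u + 1) :=
  Sᵒᵖ ⥤+ AddCommGrpCat.{u}

/-- A left resolution `⋯ ⟶ M₂ ⟶ M₁ ⟶ M₀ ⟶ X ⟶ 0` of an object `X` of an abelian category, that is,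
an exact sequence of this form. -/
structure LeftResolution {A : Type*} [Category* A] [Abelian A] (X : A) where
  obj : ℕ → A
  d (n : ℕ) : obj (n + 1) ⟶ obj n
  ε : obj 0 ⟶ X
  d_comp_d (n : ℕ) : d (n + 1) ≫ d n = 0
  d_comp_ε : d 0 ≫ ε = 0
  exact_succ (n : ℕ) : (ShortComplex.mk (d (n + 1)) (d n) (d_comp_d n)).Exact
  exact_zero : (ShortComplex.mk (d 0) ε d_comp_ε).Exact
  epi_ε : Epi ε

namespace RightMod

variable {S : Type u} [SmallCategory S] [Preadditive S]

/-- The groups `Ext` between modules are formed in the abelian category of right `S`-modules. -/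
instance hasExt : HasExt.{u + 1} (RightMod S) := HasExt.standard _

/-- `M` is finitely generated: there are finitely many elements `x i ∈ M (s i)` such that every
`y ∈ M t` is a linear combination `∑ i, x i · f i` for some `f i : t ⟶ s i`. -/
def IsFinitelyGenerated (M : RightMod S) : Prop :=
  ∃ (n : ℕ) (s : Fin n → S) (x : ∀ i, M.obj.obj (op (s i))),
    ∀ (t : S) (y : M.obj.obj (op t)), ∃ f : ∀ i, t ⟶ s i, y = ∑ i, M.obj.map (f i).op (x i)

/-- A module is flat if it is a direct limit (a colimit indexed by a directed poset) of finitely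
generated projective modules. -/
def IsFlat (F : RightMod S) : Prop :=
  ∃ (J : Type u) (_ : PartialOrder J) (_ : IsDirectedOrder J) (_ : Nonempty J)
    (pres : ColimitPresentation J F),
    ∀ j, IsFinitelyGenerated (pres.diag.obj j) ∧ Projective (pres.diag.obj j)

/-- A module `Y` is cotorsion if `Ext¹(F, Y) = 0` for all flat modules `F`. -/
def IsCotorsion (Y : RightMod S) : Prop :=
  ∀ F : RightMod S, IsFlat F → Subsingleton (Abelian.Ext F Y 1)

/-- `F` has finite flat dimension: for some `n` there is an exact sequence
`0 ⟶ M n ⟶ ⋯ ⟶ M 0 ⟶ F ⟶ 0` with all `M i` flat. -/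
def HasFiniteFlatDimension (F : RightMod S) : Prop :=
  ∃ (n : ℕ) (R : LeftResolution F),
    (∀ i, IsFlat (R.obj i)) ∧ ∀ i, n < i → IsZero (R.obj i)

end RightMod

/-!
Let `𝒳` be the class of objects `X` with a left resolution `⋯ ⟶ I₁ ⟶ I₀ ⟶ X ⟶ 0` by injectives
(`injectivelyResolved`), and `𝒲` the class of objects `F` with `Ext¹(F, X) = 0` for all `X ∈ 𝒳`
(`injectivelyResolvedOrthogonal`). The claim is that `𝒲` contains all modules of finite flat
dimension.

Every `X ∈ 𝒳` is a quotient of an injective by an object of `𝒳`, and if `X` is embedded into an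
injective then the cokernel is in `𝒳` again. Dimension shifting along these two sequences shows that
in a short exact sequence `0 ⟶ F₁ ⟶ F₂ ⟶ F₃ ⟶ 0` with `F₂ ∈ 𝒲` one has `F₁ ∈ 𝒲` if and only if
`F₃ ∈ 𝒲` (`X₁_of_shortExact`, `X₃_of_shortExact`). Closure under cokernels of monomorphisms reduces
finite flat dimension to the flat case (`of_leftResolution`), and it makes Eklof's lemma
particularly strong: the union of a continuous well-ordered chain of subobjects that lie in `𝒲` lies
in `𝒲`, with no condition on the successive quotients (`iSup_of_wellOrdered`).

It remains to see that a colimit of projectives `D j` over a directed preorder `J` is in `𝒲`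
(`colimit_of_directed`). This goes by induction on the cardinality of `J`. If `J` is finite, it has
a greatest element. If `J` is infinite, it is the union of a continuous well-ordered chain of
directed subsets `T` of smaller cardinality. The kernel `relations D T` of
`∐_{j ∈ T} D j ⟶ colim_{j ∈ T} D j`, regarded as a subobject of `∐_{j ∈ J} D j`, is in `𝒲`, because
the colimit over `T` is, by induction. These subobjects form a continuous chain with union
`relations D J`, since `relations D T` is generated by the images of `D i` for the pairs `i ≤ j` in
`T` (`relations_le_iff`). By Eklof's lemma `relations D J` is in `𝒲`, hence so is `colim_J D`.

All this takes place in a Grothendieck abelian category; right `S`-modules form one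
(`RightMod.isGrothendieckAbelian`).
-/

universe v w

/-! ### Right modules form a Grothendieck abelian category -/

section AdditiveFunctorsAB5

variable (C : Type*) [Category* C] [Preadditive C] (D : Type*) [Category* D] [Abelian D]

instance additiveFunctor_isClosedUnderColimitsOfShape (J : Type*) [Category* J]
    [HasColimitsOfShape J D] : (additiveFunctor C D).IsClosedUnderColimitsOfShape J where
  colimitsOfShape_le := by
    rintro F ⟨p⟩
    refine { map_add := fun {X Y f g} => ?_ }
    have hX := isColimitOfPreserves ((evaluation C D).obj X) p.isColimit
    refine hX.hom_ext fun j => ?_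
    have : (p.diag.obj j).Additive := p.prop_diag_obj j
    have key : ∀ h : X ⟶ Y, (p.ι.app j).app X ≫ F.map h =
        (p.diag.obj j).map h ≫ (p.ι.app j).app Y := fun h => ((p.ι.app j).naturality h).symm
    change (p.ι.app j).app X ≫ F.map (f + g) = (p.ι.app j).app X ≫ (F.map f + F.map g)
    rw [Preadditive.comp_add, key, key, key, Functor.map_add, Preadditive.add_comp]

instance additiveFunctor_isClosedUnderLimitsOfShape (J : Type*) [Category* J]
    [HasLimitsOfShape J D] : (additiveFunctor C D).IsClosedUnderLimitsOfShape J where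
  limitsOfShape_le := by
    rintro F ⟨p⟩
    refine { map_add := fun {X Y f g} => ?_ }
    have hY := isLimitOfPreserves ((evaluation C D).obj Y) p.isLimit
    refine hY.hom_ext fun j => ?_
    have : (p.diag.obj j).Additive := p.prop_diag_obj j
    have key : ∀ h : X ⟶ Y, F.map h ≫ (p.π.app j).app Y =
        (p.π.app j).app X ≫ (p.diag.obj j).map h := fun h => (p.π.app j).naturality h
    change F.map (f + g) ≫ (p.π.app j).app Y = (F.map f + F.map g) ≫ (p.π.app j).app Y
    rw [Preadditive.add_comp, key, key, key, Functor.map_add, Preadditive.comp_add]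

instance additiveFunctor_forget_preservesFiniteLimits :
    PreservesFiniteLimits (AdditiveFunctor.forget C D) where
  preservesFiniteLimits _ _ _ := inferInstance

instance additiveFunctor_hasExactColimitsOfShape (J : Type*) [Category* J]
    [HasColimitsOfShape J D] [HasExactColimitsOfShape J D] :
    HasExactColimitsOfShape J (C ⥤+ D) :=
  have : ReflectsFiniteLimits (AdditiveFunctor.forget C D) :=
    reflectsFiniteLimits_of_reflectsIsomorphisms _
  HasExactColimitsOfShape.domain_of_functor J (AdditiveFunctor.forget C D)

end AdditiveFunctorsAB5

namespace RightMod

variable (S : Type u) [SmallCategory S] [Preadditive S]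

/-- The representable modules `S(-, s)` form a separating family, by the Yoneda lemma. -/
instance hasSeparator : HasSeparator (RightMod S) where
  hasSeparator := by
    let G (s : S) : RightMod S := AdditiveFunctor.of (preadditiveYoneda.obj s)
    refine ⟨∐ G, ObjectProperty.IsSeparating.isSeparator_coproduct ?_⟩
    rw [Preadditive.isSeparating_iff]
    intro M N f hf
    ext s x
    have map_add {t : S} (g g' : t ⟶ s.unop) :
        M.obj.map (g + g').op x = M.obj.map g.op x + M.obj.map g'.op x := by
      rw [op_add, Functor.map_add]
      rfl
    let h : G s.unop ⟶ M := ObjectProperty.homMk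
      { app t := AddCommGrpCat.ofHom
          (AddMonoidHom.mk' (fun g : t.unop ⟶ s.unop => M.obj.map g.op x) map_add)
        naturality t t' u := by
          ext g
          exact ConcreteCategory.congr_hom (M.obj.map_comp (Quiver.Hom.op (Y := s.unop) g) u) x }
    have key : (h ≫ f).hom.app s (𝟙 s.unop) = f.hom.app s x :=
      congrArg (f.hom.app s) (ConcreteCategory.congr_hom (M.obj.map_id s) x)
    rw [← key, hf _ ⟨s.unop⟩ h]
    rfl

instance isGrothendieckAbelian : IsGrothendieckAbelian.{u} (RightMod S) where
  locallySmall := inferInstance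
  hasFilteredColimitsOfSize := ⟨fun _ _ _ => inferInstance⟩
  ab5OfSize :=
    have : HasFilteredColimitsOfSize.{u, u} (RightMod S) := ⟨fun _ _ _ => inferInstance⟩
    ⟨fun _ _ _ => inferInstance⟩

end RightMod

/-! ### Objects with a left resolution by injectives and their orthogonal class -/

namespace LeftResolution

variable {A : Type*} [Category* A] [Abelian A]

/-- A left resolution of `X` restricts to a left resolution of the first syzygy `ker ε` of `X`. -/
noncomputable def syzygy {X : A} (R : LeftResolution X) : LeftResolution (kernel R.ε) where
  obj n := R.obj (n + 1)
  d n := R.d (n + 1)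
  ε := kernel.lift R.ε (R.d 0) R.d_comp_ε
  d_comp_d n := R.d_comp_d (n + 1)
  d_comp_ε := by simp [← cancel_mono (kernel.ι R.ε), R.d_comp_d 0]
  exact_succ n := R.exact_succ (n + 1)
  exact_zero := by
    refine (ShortComplex.exact_iff_of_epi_of_isIso_of_mono
      (S₁ := ShortComplex.mk (R.d 1) (kernel.lift R.ε (R.d 0) R.d_comp_ε)
        (by simp [← cancel_mono (kernel.ι R.ε), R.d_comp_d 0]))
      (S₂ := ShortComplex.mk (R.d 1) (R.d 0) (R.d_comp_d 0))
      { τ₁ := 𝟙 _, τ₂ := 𝟙 _, τ₃ := kernel.ι R.ε }).2 (R.exact_succ 0)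
  epi_ε := R.exact_zero.epi_kernelLift

/-- Splicing a short exact sequence `0 ⟶ X₁ ⟶ X₂ ⟶ X₃ ⟶ 0` with a left resolution of `X₁`
produces a left resolution of `X₃`. -/
def splice {T : ShortComplex A} (hT : T.ShortExact) (R : LeftResolution T.X₁) :
    LeftResolution T.X₃ where
  obj
    | 0 => T.X₂
    | n + 1 => R.obj n
  d
    | 0 => R.ε ≫ T.f
    | n + 1 => R.d n
  ε := T.g
  d_comp_d
    | 0 => by simp [reassoc_of% R.d_comp_ε]
    | n + 1 => R.d_comp_d n
  d_comp_ε := by simp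
  exact_succ
    | 0 => by
      have := hT.mono_f
      exact (ShortComplex.exact_iff_of_epi_of_isIso_of_mono
        (S₁ := ShortComplex.mk (R.d 0) R.ε R.d_comp_ε)
        (S₂ := ShortComplex.mk (R.d 0) (R.ε ≫ T.f) (by simp [reassoc_of% R.d_comp_ε]))
        { τ₁ := 𝟙 _, τ₂ := 𝟙 _, τ₃ := T.f }).1 R.exact_zero
    | n + 1 => R.exact_succ n
  exact_zero := by
    have := R.epi_ε
    exact (ShortComplex.exact_iff_of_epi_of_isIso_of_mono
      (S₁ := ShortComplex.mk (R.ε ≫ T.f) T.g (by simp)) (S₂ := T)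
      { τ₁ := R.ε, τ₂ := 𝟙 _, τ₃ := 𝟙 _ }).2 hT.exact
  epi_ε := hT.epi_g

/-- The short exact sequence `0 ⟶ ker ε ⟶ M₀ ⟶ X ⟶ 0` at the end of a left resolution. -/
lemma shortExact_kernel {X : A} (R : LeftResolution X) :
    (ShortComplex.mk (kernel.ι R.ε) R.ε (kernel.condition _)).ShortExact :=
  have := R.epi_ε
  { exact := ShortComplex.kernelSequence_exact _
    mono_f := inferInstanceAs (Mono (kernel.ι R.ε))
    epi_g := R.epi_ε }

end LeftResolution

section Orthogonality

variable {A : Type*} [Category* A] [Abelian A]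

/-- The objects `X` admitting a left resolution `⋯ ⟶ I₁ ⟶ I₀ ⟶ X ⟶ 0` by injective objects. -/
def injectivelyResolved (A : Type*) [Category* A] [Abelian A] : ObjectProperty A :=
  fun X => ∃ R : LeftResolution X, ∀ n, Injective (R.obj n)

lemma injectivelyResolved.exists_syzygy {X : A} (hX : injectivelyResolved A X) :
    ∃ (Y I : A) (i : Y ⟶ I) (p : I ⟶ X) (w : i ≫ p = 0),
      (ShortComplex.mk i p w).ShortExact ∧ Injective I ∧ injectivelyResolved A Y := by
  obtain ⟨R, hR⟩ := hX
  exact ⟨_, _, _, _, _, R.shortExact_kernel, hR 0, R.syzygy, fun n => hR (n + 1)⟩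

lemma injectivelyResolved.of_shortExact {T : ShortComplex A} (hT : T.ShortExact)
    (h₁ : injectivelyResolved A T.X₁) [Injective T.X₂] : injectivelyResolved A T.X₃ := by
  obtain ⟨R, hR⟩ := h₁
  refine ⟨R.splice hT, ?_⟩
  rintro (_ | n)
  · exact inferInstanceAs (Injective T.X₂)
  · exact hR n

lemma CategoryTheory.Abelian.shortExact_injective_ι [EnoughInjectives A] (X : A) :
    (ShortComplex.mk (Injective.ι X) (cokernel.π (Injective.ι X))
      (cokernel.condition _)).ShortExact where
  exact := ShortComplex.cokernelSequence_exact _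
  mono_f := inferInstanceAs (Mono (Injective.ι X))
  epi_g := inferInstanceAs (Epi (cokernel.π (Injective.ι X)))

/-- The epimorphisms `E ⟶ M` with `E` injective whose kernel has a left resolution by injective
objects. Lifting against them detects `Ext¹`-orthogonality to `injectivelyResolved`. -/
def injectivelyResolvedEpi (A : Type*) [Category* A] [Abelian A] : MorphismProperty A :=
  fun E _ p => ∃ (X : A) (i : X ⟶ E) (w : i ≫ p = 0),
    (ShortComplex.mk i p w).ShortExact ∧ Injective E ∧ injectivelyResolved A X

variable [HasExt.{w} A]

open Abelian

/-- The left `Ext¹`-orthogonal class of the objects admitting a left resolution by injectives. -/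
def injectivelyResolvedOrthogonal (A : Type*) [Category* A] [Abelian A] [HasExt.{w} A] :
    ObjectProperty A :=
  fun F => ∀ X, injectivelyResolved A X → Subsingleton (Ext F X 1)

namespace injectivelyResolvedOrthogonal

lemma of_projective (P : A) [Projective P] : injectivelyResolvedOrthogonal A P :=
  fun _ _ => Ext.subsingleton_of_projective _ _ 0

/-- `Ext²` also vanishes, because an object with a left resolution by injectives embeds into an
injective object with a cokernel of the same kind. -/
lemma ext_two_eq_zero [EnoughInjectives A] {F X : A} (hF : injectivelyResolvedOrthogonal A F)
    (hX : injectivelyResolved A X) (x : Ext F X 2) : x = 0 := by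
  have hT := shortExact_injective_ι X
  obtain ⟨y, rfl⟩ := Ext.covariant_sequence_exact₁ F hT x
    (Ext.eq_zero_of_injective (n := 1) _) rfl
  have := hF _ (hX.of_shortExact hT)
  rw [Subsingleton.elim y 0, Ext.zero_comp]

lemma X₁_of_shortExact [EnoughInjectives A] {T : ShortComplex A} (hT : T.ShortExact)
    (h₂ : injectivelyResolvedOrthogonal A T.X₂) (h₃ : injectivelyResolvedOrthogonal A T.X₃) :
    injectivelyResolvedOrthogonal A T.X₁ := fun X hX => by
  have := h₂ X hX
  refine subsingleton_of_forall_eq 0 fun x => ?_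
  obtain ⟨y, rfl⟩ := Ext.contravariant_sequence_exact₁ hT X x rfl (h₃.ext_two_eq_zero hX _)
  rw [Subsingleton.elim y 0, Ext.comp_zero]

lemma X₃_of_shortExact {T : ShortComplex A} (hT : T.ShortExact)
    (h₁ : injectivelyResolvedOrthogonal A T.X₁) (h₂ : injectivelyResolvedOrthogonal A T.X₂) :
    injectivelyResolvedOrthogonal A T.X₃ := fun X hX => by
  -- `X` is a quotient of an injective by some `Y` of the same kind; then `Ext¹(-, X) ≅ Ext²(-, Y)`.
  obtain ⟨Y, I, i, p, w, hS, _, hY⟩ := hX.exists_syzygy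
  have := h₁ Y hY
  have := h₂ X hX
  refine subsingleton_of_forall_eq 0 fun x => ?_
  have hx : (x.comp hS.extClass (rfl : 1 + 1 = 2)) = 0 := by
    obtain ⟨y, hy⟩ := Ext.contravariant_sequence_exact₃ hT Y (x.comp hS.extClass (rfl : 1 + 1 = 2))
      (by
        rw [← Ext.comp_assoc _ _ _ (zero_add 1) (rfl : 1 + 1 = 2) (by rfl),
          Subsingleton.elim ((Ext.mk₀ T.g).comp x (zero_add 1)) 0, Ext.zero_comp]) rfl
    rw [← hy, Subsingleton.elim y 0, Ext.comp_zero]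
  obtain ⟨z, rfl⟩ := Ext.covariant_sequence_exact₃ T.X₃ hS x rfl hx
  rw [Ext.eq_zero_of_injective (n := 0) z, Ext.zero_comp]

/-- Maps out of an orthogonal object lift along `injectivelyResolvedEpi`. -/
lemma exists_lift {F E M : A} (hF : injectivelyResolvedOrthogonal A F) {p : E ⟶ M}
    (hp : injectivelyResolvedEpi A p) (g : F ⟶ M) : ∃ l : F ⟶ E, l ≫ p = g := by
  obtain ⟨X, i, w, hS, _, hX⟩ := hp
  have := hF X hX
  obtain ⟨y, hy⟩ := Ext.covariant_sequence_exact₃ F hS (Ext.mk₀ g) rfl (Subsingleton.elim _ _)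
  obtain ⟨l, rfl⟩ := (Ext.mk₀_bijective _ _).2 y
  exact ⟨l, (Ext.mk₀_bijective _ _).1 (by simpa using hy)⟩

/-- The converse of `exists_lift`: if `0 ⟶ X ⟶ E ⟶ M ⟶ 0` is exact with `E` injective, then
`Ext¹(F, X)` is the cokernel of `Hom(F, E) ⟶ Hom(F, M)`. -/
lemma of_exists_lift [EnoughInjectives A] {F : A}
    (hF : ∀ ⦃E M : A⦄ (p : E ⟶ M), injectivelyResolvedEpi A p → ∀ g : F ⟶ M,
      ∃ l : F ⟶ E, l ≫ p = g) : injectivelyResolvedOrthogonal A F := fun X hX => by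
  have hT := shortExact_injective_ι X
  refine subsingleton_of_forall_eq 0 fun x => ?_
  obtain ⟨y, rfl⟩ := Ext.covariant_sequence_exact₁ F hT x
    (Ext.eq_zero_of_injective (n := 0) _) rfl
  obtain ⟨g, rfl⟩ := (Ext.mk₀_bijective _ _).2 y
  obtain ⟨l, rfl⟩ := hF _ ⟨_, _, _, hT, inferInstance, hX⟩ g
  have : Ext.mk₀ (l ≫ cokernel.π (Injective.ι X)) =
    (Ext.mk₀ l).comp (Ext.mk₀ (cokernel.π (Injective.ι X))) (zero_add 0) := by simp
  rw [this, Ext.comp_assoc_of_second_deg_zero]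
  erw [hT.comp_extClass]
  rw [Ext.comp_zero]

open ZeroObject in
lemma of_llp [EnoughInjectives A] {F : A}
    (hF : (injectivelyResolvedEpi A).llp (0 : 0 ⟶ F)) : injectivelyResolvedOrthogonal A F :=
  of_exists_lift fun _ _ p hp g => by
    have := hF p hp
    have sq : CommSq 0 (0 : 0 ⟶ F) p g := ⟨by simp⟩
    exact ⟨sq.lift, sq.fac_right⟩

/-- The inductive step of Eklof's lemma: a lift along an epimorphism from an injective object
extends across a monomorphism with orthogonal cokernel. -/
lemma llp_of_shortExact {T : ShortComplex A} (hT : T.ShortExact)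
    (h₃ : injectivelyResolvedOrthogonal A T.X₃) : (injectivelyResolvedEpi A).llp T.f := by
  intro E M p hp
  refine ⟨fun {a b} sq => ?_⟩
  have := hT.mono_f
  have := hT.epi_g
  have : Injective E := hp.choose_spec.choose_spec.choose_spec.2.1
  -- Extend `a` to `T.X₂` by injectivity; the failure of this to lift `b` factors through `T.X₃`.
  let a' := Injective.factorThru a T.f
  have ha' : T.f ≫ a' = a := Injective.comp_factorThru a T.f
  have h₀ : T.f ≫ (b - a' ≫ p) = 0 := by
    rw [Preadditive.comp_sub, reassoc_of% ha', sq.w, sub_self]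
  obtain ⟨l, hl⟩ := h₃.exists_lift hp (hT.exact.desc _ h₀)
  exact ⟨⟨{ l := a' + T.g ≫ l, fac_left := by simp [ha'], fac_right := by simp [hl] }⟩⟩

lemma of_iso [EnoughInjectives A] {F G : A} (e : F ≅ G) (hF : injectivelyResolvedOrthogonal A F) :
    injectivelyResolvedOrthogonal A G :=
  of_exists_lift fun E M p hp g => by
    obtain ⟨l, hl⟩ := hF.exists_lift hp (e.hom ≫ g)
    exact ⟨e.inv ≫ l, by simp [hl]⟩

end injectivelyResolvedOrthogonal

end Orthogonality

/-! ### Eklof's lemma -/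

namespace injectivelyResolvedOrthogonal

variable {A : Type u} [Category.{v} A] [Abelian A] [IsGrothendieckAbelian.{v} A] [HasExt.{w} A]

open ZeroObject in
/-- A form of **Eklof's lemma**: if all members of a continuous well-ordered chain of subobjects are
orthogonal, then so is their union. The successive quotients are orthogonal automatically, as
cokernels of monomorphisms between orthogonal objects. -/
lemma iSup_of_wellOrdered {P : A} {Λ : Type v} [LinearOrder Λ] [WellFoundedLT Λ] [Nonempty Λ]
    (K : Λ → Subobject P) (hK : Monotone K)
    (hlim : ∀ m, Order.IsSuccLimit m → K m ≤ ⨆ b : Set.Iio m, K b)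
    (h : ∀ a, injectivelyResolvedOrthogonal A (K a : A)) :
    injectivelyResolvedOrthogonal A ((⨆ a, K a : Subobject P) : A) := by
  let _ : OrderBot Λ := WellFoundedLT.toOrderBot Λ
  let _ : SuccOrder Λ := .ofLinearWellFoundedLT Λ
  let F : Λ ⥤ MonoOver P :=
    { obj a := MonoOver.mk (K a).arrow
      map f := MonoOver.homMk (Subobject.ofLE _ _ (hK (leOfHom f))) }
  -- By AB5, the colimit of a chain of subobjects, computed in `A`, is their supremum.
  have hF : (F ⋙ MonoOver.forget _ ⋙ Over.forget _).IsWellOrderContinuous :=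
    { nonempty_isColimit m hm := ⟨by
        have := hm.nonempty_Iio.to_subtype
        let c := (Set.principalSegIio m).cocone (F ⋙ MonoOver.forget _)
        have : Mono c.pt.hom := inferInstanceAs (Mono (K m).arrow)
        apply IsGrothendieckAbelian.isColimitMapCoconeOfSubobjectMkEqISup
          ((Set.principalSegIio m).monotone.functor ⋙ F) c
        change Subobject.mk (K m).arrow = ⨆ b : Set.Iio m, Subobject.mk (K b).arrow
        simp only [Subobject.mk_arrow]
        exact le_antisymm (hlim m hm) (iSup_le fun b => hK b.2.le)⟩ }
  let c : Cocone (F ⋙ MonoOver.forget _) :=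
    { pt := Over.mk (⨆ a, K a : Subobject P).arrow
      ι :=
        { app a := Over.homMk (Subobject.ofLE _ _ (le_iSup K a))
          naturality a b f := by
            ext
            change Subobject.ofLE _ _ _ ≫ Subobject.ofLE _ _ _ = Subobject.ofLE _ _ _ ≫ 𝟙 _
            simp } }
  have : Mono c.pt.hom := inferInstanceAs (Mono (⨆ a, K a : Subobject P).arrow)
  have hc := IsGrothendieckAbelian.isColimitMapCoconeOfSubobjectMkEqISup F c (by
    change Subobject.mk (⨆ a, K a : Subobject P).arrow = ⨆ a, Subobject.mk (K a).arrow
    simp only [Subobject.mk_arrow])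
  have hmap (a b : Λ) (hab : a ≤ b) :
      (injectivelyResolvedEpi A).llp (Subobject.ofLE _ _ (hK hab)) := by
    have hT : (ShortComplex.mk (Subobject.ofLE _ _ (hK hab)) (cokernel.π _)
        (cokernel.condition _)).ShortExact :=
      { exact := ShortComplex.cokernelSequence_exact _
        mono_f := inferInstanceAs (Mono (Subobject.ofLE _ _ (hK hab)))
        epi_g := inferInstanceAs (Epi (cokernel.π _)) }
    exact llp_of_shortExact hT (X₃_of_shortExact hT (h a) (h b))
  let τ : (injectivelyResolvedEpi A).llp.TransfiniteCompositionOfShape Λ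
      (Subobject.ofLE _ _ (le_iSup K ⊥)) :=
    { F := F ⋙ MonoOver.forget _ ⋙ Over.forget _
      isoBot := Iso.refl _
      incl := ((Over.forget _).mapCocone c).ι
      isColimit := hc
      fac := Category.id_comp _
      map_mem a _ := hmap a _ (Order.le_succ a) }
  have h₁ : (injectivelyResolvedEpi A).llp (Subobject.ofLE _ _ (le_iSup K ⊥)) :=
    MorphismProperty.transfiniteCompositionsOfShape_le _ _ _ τ.mem
  refine of_llp ?_
  -- The bottom of the chain need not be zero; `0 ⟶ K ⊥` has the lifting property as `K ⊥` is
  -- orthogonal.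
  have w : (0 : 0 ⟶ (K ⊥ : A)) ≫ 𝟙 _ = 0 := zero_comp
  have h₀ : (injectivelyResolvedEpi A).llp (0 : 0 ⟶ (K ⊥ : A)) :=
    llp_of_shortExact (T := ShortComplex.mk _ _ w)
      { exact := (ShortComplex.exact_iff_mono _ rfl).2 (inferInstanceAs (Mono (𝟙 (K ⊥ : A))))
        mono_f := ⟨fun _ _ _ => (isZero_zero A).eq_of_tgt _ _⟩
        epi_g := inferInstanceAs (Epi (𝟙 (K ⊥ : A))) } (h ⊥)
  simpa using MorphismProperty.comp_mem _ _ _ h₀ h₁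

end injectivelyResolvedOrthogonal

/-! ### The relations defining a directed colimit -/

section Relations

variable {A : Type u} [Category.{v} A] [Abelian A] [IsGrothendieckAbelian.{v} A]
  {J : Type v} [Preorder J] (D : J ⥤ A)

/-- The diagram `D` restricted to the index set `T`. -/
abbrev restrictDiagram (T : Set J) : T ⥤ A :=
  Monotone.functor (f := ((↑) : T → J)) (fun _ _ h => h) ⋙ D

/-- The canonical epimorphism `∐_{j ∈ T} D j ⟶ colim_{j ∈ T} D j`. -/
noncomputable def sigmaToColimit (T : Set J) :
    (∐ fun j : T => D.obj j) ⟶ colimit (restrictDiagram D T) :=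
  Limits.Sigma.desc fun j => colimit.ι (restrictDiagram D T) j

lemma ι_sigmaToColimit (T : Set J) (j : T) :
    Sigma.ι (fun j : T => D.obj j) j ≫ sigmaToColimit D T = colimit.ι (restrictDiagram D T) j :=
  Limits.Sigma.ι_desc (f := fun j : T => D.obj j) _ _

lemma ι_sigmaToColimit_assoc (T : Set J) (j : T) {Z : A}
    (f : colimit (restrictDiagram D T) ⟶ Z) :
    Sigma.ι (fun j : T => D.obj j) j ≫ sigmaToColimit D T ≫ f =
      colimit.ι (restrictDiagram D T) j ≫ f :=
  (Category.assoc _ _ _).symm.trans (congrArg (· ≫ f) (ι_sigmaToColimit D T j))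

instance (T : Set J) : Epi (sigmaToColimit D T) := ⟨fun f g h => by
  refine colimit.hom_ext fun j => ?_
  have := Sigma.ι (fun j : T => D.obj j) j ≫= h
  rwa [ι_sigmaToColimit_assoc, ι_sigmaToColimit_assoc] at this⟩

/-- The inclusion of coproducts `∐_{j ∈ T} D j ⟶ ∐_{j ∈ J} D j`. -/
noncomputable def sigmaInclusion (T : Set J) :
    (∐ fun j : T => D.obj j) ⟶ ∐ D.obj :=
  Limits.Sigma.desc fun j => Sigma.ι D.obj j

instance (T : Set J) : Mono (sigmaInclusion D T) :=
  MonoCoprod.mono_of_injective' D.obj (Subtype.val : T → J) Subtype.val_injective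

/-- The kernel of `∐_{j ∈ T} D j ⟶ colim_{j ∈ T} D j`, as a subobject of `∐_{j ∈ J} D j`. -/
noncomputable def relations (T : Set J) : Subobject (∐ D.obj) :=
  Subobject.mk (kernel.ι (sigmaToColimit D T) ≫ sigmaInclusion D T)

/-- `relations D T` is the subobject generated by the images of `D i` under `ι_i - D(i ≤ j) ≫ ι_j`,
for `i ≤ j` in `T`. -/
lemma relations_le_iff (T : Set J) (Q : Subobject (∐ D.obj)) :
    relations D T ≤ Q ↔ ∀ (i j : J) (h : i ≤ j), i ∈ T → j ∈ T →
      Q.Factors (Sigma.ι D.obj i - D.map (homOfLE h) ≫ Sigma.ι D.obj j) := by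
  constructor
  · intro hQ i j h hi hj
    have hw : (Sigma.ι (fun j : T => D.obj j) ⟨i, hi⟩ -
        D.map (homOfLE h) ≫ Sigma.ι (fun j : T => D.obj j) ⟨j, hj⟩) ≫ sigmaToColimit D T = 0 := by
      have := colimit.w (restrictDiagram D T) (homOfLE h : (⟨i, hi⟩ : T) ⟶ ⟨j, hj⟩)
      rw [Preadditive.sub_comp, Category.assoc, ι_sigmaToColimit, ι_sigmaToColimit]
      exact sub_eq_zero.2 this.symm
    refine Subobject.factors_of_le _ hQ ((Subobject.mk_factors_iff _ _).2
      ⟨kernel.lift _ _ hw, ?_⟩)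
    have : kernel.lift (sigmaToColimit D T) _ hw ≫ kernel.ι (sigmaToColimit D T) ≫
      sigmaInclusion D T = _ := kernel.lift_ι_assoc _ _ _ _
    refine this.trans ?_
    simp [sigmaInclusion]
  · intro hQ
    let c : Cocone (restrictDiagram D T) :=
      { pt := cokernel Q.arrow
        ι :=
          { app (j : T) := (Sigma.ι D.obj j ≫ cokernel.π Q.arrow :)
            naturality (i j : T) f := by
              have h := Subobject.factorThru_arrow Q _ (hQ i j (leOfHom f) i.2 j.2) =≫
                cokernel.π Q.arrow
              rw [Category.assoc, cokernel.condition, comp_zero, Preadditive.sub_comp, eq_comm,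
                sub_eq_zero, Category.assoc] at h
              exact h.symm.trans (Category.comp_id _).symm } }
    have hc : sigmaToColimit D T ≫ colimit.desc _ c = sigmaInclusion D T ≫ cokernel.π Q.arrow :=
      Sigma.hom_ext _ _ fun j => by
        rw [ι_sigmaToColimit_assoc]
        refine (colimit.ι_desc c j).trans ?_
        simp only [sigmaInclusion, Limits.Sigma.ι_desc_assoc]
        rfl
    have h₀ : (kernel.ι (sigmaToColimit D T) ≫ sigmaInclusion D T) ≫ cokernel.π Q.arrow = 0 := by
      simp [← hc]
    have : Mono (ShortComplex.cokernelSequence Q.arrow).f := inferInstanceAs (Mono Q.arrow)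
    obtain ⟨l, hl⟩ := (ShortComplex.cokernelSequence_exact Q.arrow).lift' _ h₀
    exact Subobject.mk_le_of_comm l hl

/-- The exact sequence `0 ⟶ relations D T ⟶ ∐_{j ∈ T} D j ⟶ colim_{j ∈ T} D j ⟶ 0`. -/
lemma exists_shortExact_relations (T : Set J) :
    ∃ (f : (relations D T : A) ⟶ ∐ fun j : T => D.obj j) (w : f ≫ sigmaToColimit D T = 0),
      (ShortComplex.mk f (sigmaToColimit D T) w).ShortExact := by
  let e : (relations D T : A) ≅ kernel (sigmaToColimit D T) := Subobject.underlyingIso _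
  have w : (e.hom ≫ kernel.ι (sigmaToColimit D T)) ≫ sigmaToColimit D T = 0 := by simp
  exact ⟨_, w, (ShortComplex.shortExact_iff_of_iso (ShortComplex.isoMk (S₁ := ShortComplex.mk _ _ w)
    (S₂ := ShortComplex.mk _ _ (kernel.condition (sigmaToColimit D T))) e (Iso.refl _) (Iso.refl _)
    (by simp) (by simp))).2
    { exact := ShortComplex.kernelSequence_exact _
      mono_f := inferInstanceAs (Mono (kernel.ι (sigmaToColimit D T)))
      epi_g := inferInstanceAs (Epi (sigmaToColimit D T)) }⟩

end Relations

/-! ### Colimits over well-ordered unions of index sets -/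

namespace injectivelyResolvedOrthogonal

variable {A : Type u} [Category.{v} A] [Abelian A] [IsGrothendieckAbelian.{v} A] [HasExt.{w} A]
  {J : Type v} [Preorder J] (D : J ⥤ A) [∀ j, Projective (D.obj j)]

/-- The relations and the colimit are the ends of a short exact sequence whose middle term is a
coproduct of projectives. -/
lemma relations_iff_colimit (T : Set J) :
    injectivelyResolvedOrthogonal A (relations D T : A) ↔
      injectivelyResolvedOrthogonal A (colimit (restrictDiagram D T)) := by
  obtain ⟨f, w, hT⟩ := exists_shortExact_relations D T
  have h := of_projective (∐ fun j : T => D.obj j)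
  exact ⟨fun h₁ => X₃_of_shortExact hT h₁ h, fun h₃ => X₁_of_shortExact hT h h₃⟩

/-- Let `J` be the union of a continuous well-ordered chain of subsets `T a`. If the colimits of a
diagram of projectives over all the `T a` are orthogonal, then so is the colimit over `J`. The maps
between these colimits need not be monomorphisms, but the maps between the subobjects of relations
are, so that Eklof's lemma applies to the latter. -/
lemma colimit_of_wellOrdered {Λ : Type v} [LinearOrder Λ] [WellFoundedLT Λ] [Nonempty Λ]
    (T : Λ → Set J) (hT : Monotone T)
    (hlim : ∀ m, Order.IsSuccLimit m → T m ⊆ ⋃ b : Set.Iio m, T b)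
    (hJ : ∀ j, ∃ a, j ∈ T a)
    (h : ∀ a, injectivelyResolvedOrthogonal A (colimit (restrictDiagram D (T a)))) :
    injectivelyResolvedOrthogonal A (colimit D) := by
  have hmem (a : Λ) (i j : J) (hij : i ≤ j) (hi : i ∈ T a) (hj : j ∈ T a) :=
    (relations_le_iff D (T a) _).1 le_rfl i j hij hi hj
  have h₁ := iSup_of_wellOrdered (fun a => relations D (T a))
    (fun a b hab => (relations_le_iff D (T a) _).2 fun i j hij hi hj =>
      hmem b i j hij (hT hab hi) (hT hab hj))
    (fun m hm => (relations_le_iff D (T m) _).2 fun i j hij hi hj => by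
      obtain ⟨b, hb⟩ := Set.mem_iUnion.1 (hlim m hm hi)
      obtain ⟨b', hb'⟩ := Set.mem_iUnion.1 (hlim m hm hj)
      exact Subobject.factors_of_le _
        (le_iSup (fun b : Set.Iio m => relations D (T b)) (max b b'))
        (hmem _ i j hij (hT (le_max_left b b') hb) (hT (le_max_right b b') hb')))
    (fun a => (relations_iff_colimit D (T a)).2 (h a))
  have h₂ : (⨆ a, relations D (T a)) = relations D Set.univ := by
    refine le_antisymm (iSup_le fun a => (relations_le_iff D (T a) _).2 fun i j hij _ _ =>
      (relations_le_iff D Set.univ _).1 le_rfl i j hij trivial trivial)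
      ((relations_le_iff D _ _).2 fun i j hij _ _ => ?_)
    obtain ⟨b, hb⟩ := hJ i
    obtain ⟨b', hb'⟩ := hJ j
    exact Subobject.factors_of_le _ (le_iSup (fun b => relations D (T b)) (max b b'))
      (hmem _ i j hij (hT (le_max_left b b') hb) (hT (le_max_right b b') hb'))
  rw [h₂, relations_iff_colimit] at h₁
  exact h₁.of_iso (HasColimit.isoOfEquivalence
    (OrderIso.Set.univ (α := J)).equivalence (Iso.refl _))

end injectivelyResolvedOrthogonal

/-! ### Directed subsets of smaller cardinality -/

section DirectedSets

open Cardinal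

variable {Λ : Type*} {J : Type*} [Preorder J] [IsDirectedOrder J] [Nonempty J]

open Classical in
/-- An upper bound in `J` of the family `e` over the finite set `s`, chosen recursively so as to
bound also the elements chosen for all proper subsets of `s`. -/
noncomputable def finsetBound (e : Λ → J) (s : Finset Λ) : J :=
  Finset.strongInduction (fun s ih => (Finset.exists_le
    (s.image e ∪ s.ssubsets.attach.image fun t => ih t.1 (Finset.mem_ssubsets.1 t.2))).choose) s

open Classical in
lemma finsetBound_eq (e : Λ → J) (s : Finset Λ) :
    finsetBound e s = (Finset.exists_le
      (s.image e ∪ s.ssubsets.attach.image fun t => finsetBound e t.1)).choose :=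
  Finset.strongInduction_eq _ _

open Classical in
lemma le_finsetBound_of_mem (e : Λ → J) (s : Finset Λ) {i : J}
    (hi : i ∈ s.image e ∪ s.ssubsets.attach.image fun t => finsetBound e t.1) :
    i ≤ finsetBound e s := by
  rw [finsetBound_eq]
  exact (Finset.exists_le _).choose_spec i hi

lemma le_finsetBound (e : Λ → J) {s : Finset Λ} {x : Λ} (hx : x ∈ s) : e x ≤ finsetBound e s := by
  classical
  exact le_finsetBound_of_mem e s (Finset.mem_union_left _ (Finset.mem_image_of_mem _ hx))

lemma finsetBound_mono (e : Λ → J) : Monotone (finsetBound e) := by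
  classical
  intro t s hts
  obtain rfl | hts := eq_or_ssubset_of_subset hts
  · exact le_rfl
  · exact le_finsetBound_of_mem e s (Finset.mem_union_right _ (Finset.mem_image.2
      ⟨⟨t, Finset.mem_ssubsets.2 hts⟩, Finset.mem_attach _ _, rfl⟩))

/-- The directed set generated by the family `e` restricted to `U`: the values of `e` on `U`
together with the chosen bounds for the finite subsets of `U`. -/
def directedHull (e : Λ → J) (U : Set Λ) : Set J :=
  e '' U ∪ finsetBound e '' {s | ↑s ⊆ U}

lemma directedHull_mono (e : Λ → J) : Monotone (directedHull e) := fun _ _ h =>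
  Set.union_subset_union (Set.image_mono h) (Set.image_mono fun _ hs => hs.trans h)

lemma exists_finsetBound_of_mem_directedHull {e : Λ → J} {U : Set Λ} {j : J}
    (hj : j ∈ directedHull e U) : ∃ s : Finset Λ, ↑s ⊆ U ∧ j ≤ finsetBound e s := by
  obtain ⟨x, hx, rfl⟩ | ⟨s, hs, rfl⟩ := hj
  · exact ⟨{x}, by simpa using hx, le_finsetBound e (Finset.mem_singleton_self x)⟩
  · exact ⟨s, hs, le_rfl⟩

instance (e : Λ → J) (U : Set Λ) : Nonempty (directedHull e U) :=
  ⟨⟨finsetBound e ∅, Or.inr ⟨∅, by simp, rfl⟩⟩⟩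

instance (e : Λ → J) (U : Set Λ) : IsDirectedOrder (directedHull e U) where
  directed := by
    classical
    rintro ⟨i, hi⟩ ⟨j, hj⟩
    obtain ⟨s, hs, his⟩ := exists_finsetBound_of_mem_directedHull hi
    obtain ⟨t, ht, hjt⟩ := exists_finsetBound_of_mem_directedHull hj
    exact ⟨⟨finsetBound e (s ∪ t), Or.inr ⟨s ∪ t, by simp [hs, ht], rfl⟩⟩,
      his.trans (finsetBound_mono e Finset.subset_union_left),
      hjt.trans (finsetBound_mono e Finset.subset_union_right)⟩

/-- A finite subset of `Iio m`, where `m` is a limit element, is contained in `Iio b` for some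
`b < m`. Therefore the directed hull of `Iio m` is the union of the directed hulls of the smaller
initial segments. -/
lemma directedHull_Iio_subset_of_isSuccLimit [LinearOrder Λ] (e : Λ → J) {m : Λ}
    (hm : Order.IsSuccLimit m) :
    directedHull e (Set.Iio m) ⊆ ⋃ b : Set.Iio m, directedHull e (Set.Iio b) := by
  have key (s : Finset Λ) (hs : ↑s ⊆ Set.Iio m) : ∃ b : Set.Iio m, ↑s ⊆ Set.Iio b.1 := by
    have : Nonempty {x // x < m} := hm.nonempty_Iio.to_subtype
    obtain ⟨b, hb⟩ := Finset.exists_le (s.subtype (· < m))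
    obtain ⟨c, hcm, hbc⟩ := hm.lt_iff_exists_lt.1 b.2
    exact ⟨⟨c, hcm⟩, fun x hx => lt_of_le_of_lt (hb ⟨x, hs hx⟩ (Finset.mem_subtype.2 hx)) hbc⟩
  rintro _ (⟨x, hx, rfl⟩ | ⟨s, hs, rfl⟩)
  · obtain ⟨b, hb⟩ := key {x} (by simpa using hx)
    exact Set.mem_iUnion.2 ⟨b, Or.inl ⟨x, by simpa using hb, rfl⟩⟩
  · obtain ⟨b, hb⟩ := key s hs
    exact Set.mem_iUnion.2 ⟨b, Or.inr ⟨s, hb, rfl⟩⟩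

/-- The directed hull is indexed by the elements and the finite subsets of `U`. In particular it is
finite if `U` is, so that the bound holds for `κ = ℵ₀` as well. -/
lemma mk_directedHull_lt {Λ J : Type v} [Preorder J] [IsDirectedOrder J] [Nonempty J] (e : Λ → J)
    {U : Set Λ} {κ : Cardinal.{v}} (hκ : ℵ₀ ≤ κ) (hU : #U < κ) : #(directedHull e U) < κ := by
  have h : #{s : Finset Λ | ↑s ⊆ U} < κ := by
    have hsub : {s : Finset Λ | ↑s ⊆ U} ⊆
        Set.range (Finset.map (Function.Embedding.subtype (· ∈ U))) := fun s hs => by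
      classical exact ⟨s.subtype (· ∈ U), Finset.subtype_map_of_mem hs⟩
    refine ((mk_le_mk_of_subset hsub).trans mk_range_le).trans_lt ?_
    cases finite_or_infinite U
    · exact (lt_aleph0_of_finite _).trans_le hκ
    · rwa [mk_finset_of_infinite]
  exact (mk_union_le _ _).trans_lt
    (add_lt_of_lt hκ (mk_image_le.trans_lt hU) (mk_image_le.trans_lt h))

end DirectedSets

/-! ### Directed colimits of projectives and finite flat dimension -/

namespace injectivelyResolvedOrthogonal

open Cardinal

variable {A : Type u} [Category.{v} A] [Abelian A] [IsGrothendieckAbelian.{v} A] [HasExt.{w} A]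

/-- Directed colimits of projectives are orthogonal to the objects with a left resolution by
injectives. -/
theorem colimit_of_directed (J : Type v) [Preorder J] [IsDirectedOrder J] [Nonempty J] (D : J ⥤ A)
    [∀ j, Projective (D.obj j)] : injectivelyResolvedOrthogonal A (colimit D) := by
  induction hκ : #J using WellFoundedLT.induction generalizing J with
  | ind κ ih =>
  subst hκ
  cases finite_or_infinite J
  · -- A finite directed preorder has a greatest element.
    have := Fintype.ofFinite J
    obtain ⟨t, ht⟩ := Finset.exists_le (Finset.univ : Finset J)
    have hT : IsTerminal t := IsTerminal.ofUniqueHom (fun j => homOfLE (ht j (Finset.mem_univ j)))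
      fun _ _ => Subsingleton.elim _ _
    exact (of_projective (D.obj t)).of_iso
      ((colimitOfDiagramTerminal hT D).coconePointUniqueUpToIso (colimit.isColimit D))
  · -- Index `J` by its initial ordinal, all of whose proper initial segments have smaller
    -- cardinality; so do the directed hulls of these segments.
    let Λ := (#J).ord.ToType
    obtain ⟨e⟩ : Nonempty (Λ ≃ J) := Cardinal.eq.1 (mk_ord_toType _)
    have : Nonempty Λ := e.nonempty
    have : NoMaxOrder Λ := Cardinal.noMaxOrder (aleph0_le_mk J)
    refine colimit_of_wellOrdered D (fun a : Λ => directedHull e (Set.Iio a))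
      (fun a b hab => directedHull_mono e (Set.Iio_subset_Iio hab))
      (fun m hm => directedHull_Iio_subset_of_isSuccLimit e hm) (fun j => ?_) (fun a => ?_)
    · obtain ⟨a, ha⟩ := exists_gt (e.symm j)
      exact ⟨a, Or.inl ⟨e.symm j, ha, by simp⟩⟩
    · have hproj : ∀ j, Projective ((restrictDiagram D (directedHull e (Set.Iio a))).obj j) :=
        fun j => inferInstanceAs (Projective (D.obj j))
      have ha : #(Set.Iio a) < #J := (mk_Iio_lt a (by simp [Λ])).trans_eq (by simp [Λ])
      exact ih _ (mk_directedHull_lt e (aleph0_le_mk J) ha) _ _ rfl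

/-- An object with a finite left resolution by orthogonal objects is orthogonal. -/
lemma of_leftResolution {F : A} (R : LeftResolution F) (n : ℕ)
    (hR : ∀ i, injectivelyResolvedOrthogonal A (R.obj i)) (hn : ∀ i, n < i → IsZero (R.obj i)) :
    injectivelyResolvedOrthogonal A F := by
  induction n generalizing F with
  | zero =>
    have := R.epi_ε
    have : Mono R.ε := R.exact_zero.mono_g ((hn 1 one_pos).eq_of_src _ _)
    have := isIso_of_mono_of_epi R.ε
    exact (hR 0).of_iso (asIso R.ε)
  | succ n ih =>
    exact X₃_of_shortExact R.shortExact_kernel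
      (ih R.syzygy (fun i => hR (i + 1)) fun i hi => hn (i + 1) (by lia)) (hR 0)

end injectivelyResolvedOrthogonal

namespace RightMod

lemma IsFlat.injectivelyResolvedOrthogonal {S : Type u} [SmallCategory S] [Preadditive S]
    {F : RightMod S} (hF : IsFlat F) : injectivelyResolvedOrthogonal (RightMod S) F := by
  obtain ⟨J, _, _, _, pres, h⟩ := hF
  have hproj : ∀ j, Projective (pres.diag.obj j) := fun j => (h j).2
  exact (injectivelyResolvedOrthogonal.colimit_of_directed J pres.diag).of_iso
    ((colimit.isColimit _).coconePointUniqueUpToIso pres.isColimit)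

end RightMod

theorem mainTheorem6 {S : Type u} [SmallCategory S] [Preadditive S] [HasFiniteBiproducts S]
    (X : RightMod S) (I : LeftResolution X) (hI : ∀ n, Injective (I.obj n)) :
    RightMod.IsCotorsion X ∧
      ∀ F : RightMod S, RightMod.HasFiniteFlatDimension F →
        Subsingleton (Abelian.Ext F X 1) := by
  refine ⟨fun F hF => hF.injectivelyResolvedOrthogonal X ⟨I, hI⟩, ?_⟩
  rintro F ⟨n, R, hR, hn⟩
  exact injectivelyResolvedOrthogonal.of_leftResolution R n
    (fun i => (hR i).injectivelyResolvedOrthogonal) hn X ⟨I, hI⟩
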